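/- **Notation.** Let $D^4$ be the free modular lattice with unity $I$ on four generators $e_1,e_2,e_3,e_4$ (join $a+b$, meet $ab$). A representation $\rho$ of $D^4$ in a finite-dimensional vector space $X$ over a field $K$ is a morphism of lattices with unity from $D^4$ to the lattice of subspaces of $X$ (so $\rho(I)=X$). The representation $\Phi^+\rho$ lives in the space $$X_0^1=\Big\{(\xi_1,\xi_2,\xi_3,\xi_4)\ \Big|\ \xi_i\in\rho(e_i),\ \sum_i\xi_i=0\Big\},\qquad \Phi^+\rho(e_i)=\{\xi\in X_0^1\mid \xi_i=0\},$$ and the elementary map $\varphi_i:X_0^1\to X$ is $(\xi_1,\xi_2,\xi_3,\xi_4)\mapsto\xi_i$. **Admissible sequences.** A non-empty sequence $i_n\dots i_1$ of indices in $\{1,2,3,4\}$ is *admissible* if adjacent indices are distinct. Two sequences are considered equal if one is obtained from the other by finitely many replacements $\dots ijl\dots=\dots ikl\dots$ with $\{i,j,k,l\}=\{1,2,3,4\}$. **Atomic elements.** $a_0^{ij}=I$ and $a_n^{ij}=e_i+e_j\,a_{n-1}^{kl}$ for $n\ge 1$, where $\{i,j,k,l\}=\{1,2,3,4\}$. To fix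 the order of $k,l$: for the upper indices $ij$ in the table below take $k<l$, and unfold the recursion with $ij$ and $kl$ alternating. **Table** (sequences with $i_1=1$; parameters $t,r,s\ge 0$). | type | $\alpha$ | $e_\alpha$ | range | |---|---|---|---| | $F21$ | $(21)^t(41)^r(31)^s$ | $e_2a^{34}_{2t-1}a^{41}_{2r}a^{31}_{2s}$ | $t\ge1$ | | $F31$ | $(31)^t(41)^r(21)^s$ | $e_3a^{24}_{2t-1}a^{41}_{2r}a^{21}_{2s}$ | $t\ge1$ | | $F41$ | $(41)^t(31)^r(21)^s$ | $e_4a^{32}_{2t-1}a^{31}_{2r}a^{21}_{2s}$ | $t\ge1$ | | $G11$ | $1(21)^t(31)^s(41)^r$ | $e_1a^{34}_{2t}a^{32}_{2r}a^{24}_{2s}$ | | | $G21$ | $2(41)^r(31)^s(21)^t$ | $e_2a^{34}_{2t}a^{14}_{2r-1}a^{31}_{2s+1}$ | $r\ge1$ | | $G31$ | $3(41)^r(21)^s(31)^t$ | $e_3a^{24}_{2t}a^{14}_{2r-1}a^{21}_{2s+1}$ | $r\ge1$ | | $G41$ | $4(21)^r(31)^s(41)^t$ | $e_4a^{32}_{2t}a^{21}_{2r-1}a^{31}_{2s+1}$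 | $r\ge1$ | | $H11$ | $(14)^r(31)^s(21)^t$ | $e_1a^{34}_{2t+1}a^{32}_{2r-1}a^{24}_{2s-1}$ | $r,s\ge1$ | | $H21$ | $2(14)^r(31)^s(21)^t$ | $e_2a^{34}_{2t+2}a^{14}_{2r-1}a^{31}_{2s-1}$ | $r,s\ge1$ | | $H31$ | $3(14)^r(31)^s(21)^t$ | $e_3a^{21}_{2t+1}a^{14}_{2r-1}a^{24}_{2s}$ | $r,s\ge1$ | | $H41$ | $4(14)^r(31)^s(21)^t$ | $e_4a^{21}_{2t+1}a^{32}_{2r}a^{31}_{2s-1}$ | $r,s\ge1$ | Further, $f_{10}=e_1(e_2+e_3+e_4)$, and for every other $\alpha=i_n\dots i_1$ of the table, with $e_\alpha=e_{i_n}a_xb_yc_z$ where $a_x,b_y,c_z$ are the three atomic factors (with lower indices $x,y,z$) in any order for which $x\ge1$, $$f_{\alpha0}=e_\alpha\,(e_{i_n}c_{z+1}+b_{y+1}a_{x-1}).$$ For sequences with arbitrary $i_1$ the elements $e_\alpha$, $f_{\alpha0}$ are obtained from these by permuting the indices $1,2,3,4$ simultaneously in $\alpha$ and in the generators. (An admissible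 sequence may be equal to several table sequences, and $f_{\alpha 0}$ has several expressions; the theorem holds for each choice.) **Theorem.** 1. For every permutation $\sigma$ of $\{1,2,3,4\}$, every admissible sequence with $i_1=\sigma(1)$ is equal to one of the sequences of the $11$ types of the table with the indices permuted by $\sigma$. In particular, an admissible sequence with $i_1=1$ is equal to one of the table. 2. Let $\alpha=i_n\dots i_1$ be an admissible sequence and $i\ne i_n$. Then $i\alpha$ is admissible, elements $e_\alpha,f_{\alpha0},e_{i\alpha},f_{i\alpha0}$ are given by the table, and for $z_\alpha=e_\alpha$ and for $z_\alpha=f_{\alpha0}$ (with whichever expressions for $z_\alpha$ and $z_{i\alpha}$) $$\varphi_i\,\Phi^+\rho(z_\alpha)=\rho(z_{i\alpha})$$ for every representation $\rho$ of $D^4$ in a finite-dimensional vector space over any field. -/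

import Mathlib

/-! Admissible sequences and admissible elements for the free modular lattice `D⁴` with unity.

The four indices `1, 2, 3, 4` are the four elements of `Fin 4` (there `4` is another name of `0`,
so the numerals `1, 2, 3, 4` are pairwise distinct and exhaust `Fin 4`). -/

namespace D4Lattice

/-- Lattice polynomials in four generators and the unity. -/
inductive Term : Type
  | gen : Fin 4 → Term
  | unity : Term
  | sup : Term → Term → Term
  | inf : Term → Term → Term

/-- The inequalities between lattice polynomials that hold in all modular lattices with unity:
the least preorder for which `sup`, `inf`, `unity` are join, meet, greatest element and
the modular law holds. -/
inductive Term.Le : Term → Term → Prop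
  | refl (a) : Term.Le a a
  | trans {a b c} : Term.Le a b → Term.Le b c → Term.Le a c
  | le_unity (a) : Term.Le a Term.unity
  | le_sup_left (a b) : Term.Le a (Term.sup a b)
  | le_sup_right (a b) : Term.Le b (Term.sup a b)
  | sup_le {a b c} : Term.Le a c → Term.Le b c → Term.Le (Term.sup a b) c
  | inf_le_left (a b) : Term.Le (Term.inf a b) a
  | inf_le_right (a b) : Term.Le (Term.inf a b) b
  | le_inf {a b c} : Term.Le a b → Term.Le a c → Term.Le a (Term.inf b c)
  | modular {a b c} : Term.Le a c →
      Term.Le (Term.inf (Term.sup a b) c) (Term.sup a (Term.inf b c))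

instance Term.setoid : Setoid Term where
  r a b := Term.Le a b ∧ Term.Le b a
  iseqv := ⟨fun a => ⟨.refl a, .refl a⟩, fun h => ⟨h.2, h.1⟩,
    fun h h' => ⟨h.1.trans h'.1, h'.2.trans h.2⟩⟩

/-- The free modular lattice `D⁴` on four generators, with unity. -/
def D4 : Type := Quotient Term.setoid

namespace D4

/-- The generators `e₁, e₂, e₃, e₄`. -/
def e (i : Fin 4) : D4 := Quotient.mk _ (Term.gen i)

instance instLattice : Lattice D4 where
  le := Quotient.lift₂ Term.Le fun _ _ _ _ h h' => propext
    ⟨fun k => (h.2.trans k).trans h'.1, fun k => (h.1.trans k).trans h'.2⟩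
  le_refl := by rintro ⟨a⟩; exact Term.Le.refl a
  le_trans := by rintro ⟨a⟩ ⟨b⟩ ⟨c⟩ h h'; exact Term.Le.trans h h'
  le_antisymm := by rintro ⟨a⟩ ⟨b⟩ h h'; exact Quotient.sound ⟨h, h'⟩
  sup := Quotient.map₂ Term.sup fun _ _ h _ _ h' =>
    ⟨.sup_le (h.1.trans (.le_sup_left _ _)) (h'.1.trans (.le_sup_right _ _)),
     .sup_le (h.2.trans (.le_sup_left _ _)) (h'.2.trans (.le_sup_right _ _))⟩
  le_sup_left := by rintro ⟨a⟩ ⟨b⟩; exact Term.Le.le_sup_left a b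
  le_sup_right := by rintro ⟨a⟩ ⟨b⟩; exact Term.Le.le_sup_right a b
  sup_le := by rintro ⟨a⟩ ⟨b⟩ ⟨c⟩ h h'; exact Term.Le.sup_le h h'
  inf := Quotient.map₂ Term.inf fun _ _ h _ _ h' =>
    ⟨.le_inf ((Term.Le.inf_le_left _ _).trans h.1) ((Term.Le.inf_le_right _ _).trans h'.1),
     .le_inf ((Term.Le.inf_le_left _ _).trans h.2) ((Term.Le.inf_le_right _ _).trans h'.2)⟩
  inf_le_left := by rintro ⟨a⟩ ⟨b⟩; exact Term.Le.inf_le_left a b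
  inf_le_right := by rintro ⟨a⟩ ⟨b⟩; exact Term.Le.inf_le_right a b
  le_inf := by rintro ⟨a⟩ ⟨b⟩ ⟨c⟩ h h'; exact Term.Le.le_inf h h'

instance instOrderTop : OrderTop D4 where
  top := Quotient.mk _ Term.unity
  le_top := by rintro ⟨a⟩; exact Term.Le.le_unity a

instance instModular : IsModularLattice D4 where
  sup_inf_le_assoc_of_le := by
    rintro ⟨a⟩ ⟨b⟩ ⟨c⟩ h; exact Term.Le.modular h

end D4

section lift
variable {L : Type*} [Lattice L] [OrderTop L]

/-- The value of a lattice polynomial. -/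
def Term.eval (v : Fin 4 → L) : Term → L
  | .gen i => v i
  | .unity => ⊤
  | .sup a b => a.eval v ⊔ b.eval v
  | .inf a b => a.eval v ⊓ b.eval v

theorem Term.Le.eval_le [IsModularLattice L] (v : Fin 4 → L) {a b : Term} (h : Term.Le a b) :
    a.eval v ≤ b.eval v := by
  induction h with
  | refl a => exact le_rfl
  | trans _ _ h h' => exact h.trans h'
  | le_unity a => exact le_top
  | le_sup_left a b => exact _root_.le_sup_left
  | le_sup_right a b => exact _root_.le_sup_right
  | sup_le _ _ h h' => exact _root_.sup_le h h'
  | inf_le_left a b => exact _root_.inf_le_left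
  | inf_le_right a b => exact _root_.inf_le_right
  | le_inf _ _ h h' => exact _root_.le_inf h h'
  | modular _ h => exact IsModularLattice.sup_inf_le_assoc_of_le _ h

/-- The universal property: the morphism from `D⁴` with prescribed values on the generators. -/
def D4.lift [IsModularLattice L] (v : Fin 4 → L) : LatticeHom D4 L where
  toFun := Quotient.lift (Term.eval v) fun _ _ h =>
    le_antisymm (h.1.eval_le v) (h.2.eval_le v)
  map_sup' := by rintro ⟨a⟩ ⟨b⟩; rfl
  map_inf' := by rintro ⟨a⟩ ⟨b⟩; rfl

end lift

/-- A linear representation of `D⁴` in the space `X`: a morphism of lattices with unity from `D⁴`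
to the lattice of subspaces of `X`. -/
structure SubspaceRep (K X : Type*) [Field K] [AddCommGroup X] [Module K X] where
  toHom : LatticeHom D4 (Submodule K X)
  map_unity : toHom ⊤ = ⊤

section Coxeter
variable {K X : Type*} [Field K] [AddCommGroup X] [Module K X]

/-- The representation with prescribed images of the generators. -/
def SubspaceRep.ofSubspaces (V : Fin 4 → Submodule K X) : SubspaceRep K X := ⟨D4.lift V, rfl⟩

/-- The space `X₀¹ = {(ξ₁, ξ₂, ξ₃, ξ₄) | ξᵢ ∈ ρ(eᵢ), ∑ ξᵢ = 0}` of the representation `Φ⁺ρ`. -/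
def SubspaceRep.coxeterSpace (ρ : SubspaceRep K X) : Submodule K (Fin 4 → X) where
  carrier := {ξ | (∀ i, ξ i ∈ ρ.toHom (D4.e i)) ∧ ∑ i, ξ i = 0}
  add_mem' := fun {a b} ha hb => ⟨fun i => add_mem (ha.1 i) (hb.1 i), by
    simp only [Pi.add_apply, Finset.sum_add_distrib, ha.2, hb.2, add_zero]⟩
  zero_mem' := ⟨fun _ => zero_mem _, by simp⟩
  smul_mem' := fun c a ha => ⟨fun i => Submodule.smul_mem _ c (ha.1 i), by
    simp only [Pi.smul_apply, ← Finset.smul_sum, ha.2, smul_zero]⟩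

/-- The elementary map `φᵢ : X₀¹ → X`, `(ξ₁, ξ₂, ξ₃, ξ₄) ↦ ξᵢ`. -/
def SubspaceRep.phi (ρ : SubspaceRep K X) (i : Fin 4) : ρ.coxeterSpace →ₗ[K] X :=
  LinearMap.proj i ∘ₗ ρ.coxeterSpace.subtype

/-- The Coxeter functor: `Φ⁺ρ` is the representation in `X₀¹` that takes the generator `eᵢ` to
`{(ξ₁, ξ₂, ξ₃, ξ₄) ∈ X₀¹ | ξᵢ = 0}`. -/
def SubspaceRep.coxeter (ρ : SubspaceRep K X) : SubspaceRep K ρ.coxeterSpace :=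
  SubspaceRep.ofSubspaces fun i => LinearMap.ker (ρ.phi i)

end Coxeter

/-- A sequence `iₙ … i₁` is the list `[iₙ, …, i₁]`. It is admissible if it is non-empty and
adjacent indices are distinct. -/
def Admissible (α : List (Fin 4)) : Prop := α ≠ [] ∧ α.IsChain (· ≠ ·)

/-- One replacement `… i j l … = … i k l …` with `i, j, k, l` all distinct. -/
inductive Step : List (Fin 4) → List (Fin 4) → Prop
  | mk (u v : List (Fin 4)) (i j k l : Fin 4) (h : [i, j, k, l].Nodup) :
      Step (u ++ [i, j, l] ++ v) (u ++ [i, k, l] ++ v)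

/-- Equality of admissible sequences: a finite number of replacements leads from one to the
other. -/
def SameSeq : List (Fin 4) → List (Fin 4) → Prop := Relation.EqvGen Step

/-- The `11` types of admissible sequences with `i₁ = 1`. -/
inductive AdmType : Type
  | F21 | F31 | F41 | G11 | G21 | G31 | G41 | H11 | H21 | H31 | H41

/-- `pw i j n` is `(ij)ⁿ`. -/
def pw (i j : Fin 4) (n : ℕ) : List (Fin 4) := (List.replicate n [i, j]).flatten

/-- The range of the parameters `t, r, s` in each type. -/
def AdmType.Valid (t r s : ℕ) : AdmType → Prop
  | .F21 | .F31 | .F41 => 1 ≤ t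
  | .G11 => True
  | .G21 | .G31 | .G41 => 1 ≤ r
  | .H11 | .H21 | .H31 | .H41 => 1 ≤ r ∧ 1 ≤ s

/-- The sequence of each type with parameters `t, r, s`. -/
def AdmType.word (t r s : ℕ) : AdmType → List (Fin 4)
  | .F21 => pw 2 1 t ++ pw 4 1 r ++ pw 3 1 s
  | .F31 => pw 3 1 t ++ pw 4 1 r ++ pw 2 1 s
  | .F41 => pw 4 1 t ++ pw 3 1 r ++ pw 2 1 s
  | .G11 => [1] ++ pw 2 1 t ++ pw 3 1 s ++ pw 4 1 r
  | .G21 => [2] ++ pw 4 1 r ++ pw 3 1 s ++ pw 2 1 t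
  | .G31 => [3] ++ pw 4 1 r ++ pw 2 1 s ++ pw 3 1 t
  | .G41 => [4] ++ pw 2 1 r ++ pw 3 1 s ++ pw 4 1 t
  | .H11 => pw 1 4 r ++ pw 3 1 s ++ pw 2 1 t
  | .H21 => [2] ++ pw 1 4 r ++ pw 3 1 s ++ pw 2 1 t
  | .H31 => [3] ++ pw 1 4 r ++ pw 3 1 s ++ pw 2 1 t
  | .H41 => [4] ++ pw 1 4 r ++ pw 3 1 s ++ pw 2 1 t

/-- The leftmost index `iₙ` of the sequences of each type. -/
def AdmType.lead : AdmType → Fin 4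
  | .G11 | .H11 => 1
  | .F21 | .G21 | .H21 => 2
  | .F31 | .G31 | .H31 => 3
  | .F41 | .G41 | .H41 => 4

/-- For `{i, j, k, l} = {1, 2, 3, 4}`, `atom i j k l n` is the atomic element `aₙ^{ij}`:
`a₀^{ij} = I` and `aₙ^{ij} = eᵢ + eⱼ aₙ₋₁^{kl}` for `n ≥ 1`. -/
def atom (i j k l : Fin 4) : ℕ → D4
  | 0 => ⊤
  | n + 1 => D4.e i ⊔ D4.e j ⊓ atom k l i j n

/-- An atomic element, as its quadruple `(i, j, k, l)` of upper indices and its lower index. -/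
structure Factor where
  i : Fin 4
  j : Fin 4
  k : Fin 4
  l : Fin 4
  n : ℕ

/-- The three atomic factors of `e_α` for each type. -/
def AdmType.factor (t r s : ℕ) : AdmType → Fin 3 → Factor
  | .F21 => ![⟨3, 4, 1, 2, 2 * t - 1⟩, ⟨4, 1, 2, 3, 2 * r⟩, ⟨3, 1, 2, 4, 2 * s⟩]
  | .F31 => ![⟨2, 4, 1, 3, 2 * t - 1⟩, ⟨4, 1, 2, 3, 2 * r⟩, ⟨2, 1, 3, 4, 2 * s⟩]
  | .F41 => ![⟨3, 2, 1, 4, 2 * t - 1⟩, ⟨3, 1, 2, 4, 2 * r⟩, ⟨2, 1, 3, 4, 2 * s⟩]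
  | .G11 => ![⟨3, 4, 1, 2, 2 * t⟩, ⟨3, 2, 1, 4, 2 * r⟩, ⟨2, 4, 1, 3, 2 * s⟩]
  | .G21 => ![⟨3, 4, 1, 2, 2 * t⟩, ⟨1, 4, 2, 3, 2 * r - 1⟩, ⟨3, 1, 2, 4, 2 * s + 1⟩]
  | .G31 => ![⟨2, 4, 1, 3, 2 * t⟩, ⟨1, 4, 2, 3, 2 * r - 1⟩, ⟨2, 1, 3, 4, 2 * s + 1⟩]
  | .G41 => ![⟨3, 2, 1, 4, 2 * t⟩, ⟨2, 1, 3, 4, 2 * r - 1⟩, ⟨3, 1, 2, 4, 2 * s + 1⟩]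
  | .H11 => ![⟨3, 4, 1, 2, 2 * t + 1⟩, ⟨3, 2, 1, 4, 2 * r - 1⟩, ⟨2, 4, 1, 3, 2 * s - 1⟩]
  | .H21 => ![⟨3, 4, 1, 2, 2 * t + 2⟩, ⟨1, 4, 2, 3, 2 * r - 1⟩, ⟨3, 1, 2, 4, 2 * s - 1⟩]
  | .H31 => ![⟨2, 1, 3, 4, 2 * t + 1⟩, ⟨1, 4, 2, 3, 2 * r - 1⟩, ⟨2, 4, 1, 3, 2 * s⟩]
  | .H41 => ![⟨2, 1, 3, 4, 2 * t + 1⟩, ⟨3, 2, 1, 4, 2 * r⟩, ⟨3, 1, 2, 4, 2 * s - 1⟩]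

/-- The atomic element of a factor with its indices permuted by `σ` and its lower index replaced
by `n`. -/
def Factor.elem (σ : Equiv.Perm (Fin 4)) (a : Factor) (n : ℕ) : D4 :=
  atom (σ a.i) (σ a.j) (σ a.k) (σ a.l) n

/-- The table element `e_α`, with all indices permuted by `σ`:
the product of `e_{iₙ}` and the three atomic factors. -/
def tableE (σ : Equiv.Perm (Fin 4)) (T : AdmType) (t r s : ℕ) : D4 :=
  D4.e (σ T.lead) ⊓ (T.factor t r s 0).elem σ (T.factor t r s 0).n ⊓
    (T.factor t r s 1).elem σ (T.factor t r s 1).n ⊓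
    (T.factor t r s 2).elem σ (T.factor t r s 2).n

/-- `TableF σ T t r s z`: `z` is one of the expressions of the table element `f_{α0}`, with all
indices permuted by `σ`. For `α = 1` it is `e₁(e₂ + e₃ + e₄)`. Otherwise, if `a_x, b_y, c_z` are
the three atomic factors of `e_α` in any order for which `x ≥ 1`, it is
`e_α (e_{iₙ} c_{z+1} + b_{y+1} a_{x-1})`. -/
inductive TableF (σ : Equiv.Perm (Fin 4)) : AdmType → ℕ → ℕ → ℕ → D4 → Prop
  | one : TableF σ .G11 0 0 0 (D4.e (σ 1) ⊓ (D4.e (σ 2) ⊔ D4.e (σ 3) ⊔ D4.e (σ 4)))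
  | mk (T : AdmType) (t r s : ℕ) (π : Equiv.Perm (Fin 3))
      (h : 1 ≤ (T.factor t r s (π 0)).n) :
      TableF σ T t r s (tableE σ T t r s ⊓
        (D4.e (σ T.lead) ⊓ (T.factor t r s (π 2)).elem σ ((T.factor t r s (π 2)).n + 1) ⊔
          (T.factor t r s (π 1)).elem σ ((T.factor t r s (π 1)).n + 1) ⊓
          (T.factor t r s (π 0)).elem σ ((T.factor t r s (π 0)).n - 1)))

/-- `z` is an admissible element `e_α`. -/
def IsE (α : List (Fin 4)) (z : D4) : Prop :=
  ∃ (σ : Equiv.Perm (Fin 4)) (T : AdmType) (t r s : ℕ), T.Valid t r s ∧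
    SameSeq α ((T.word t r s).map σ) ∧ z = tableE σ T t r s

/-- `z` is an admissible element `f_{α0}`. -/
def IsF (α : List (Fin 4)) (z : D4) : Prop :=
  ∃ (σ : Equiv.Perm (Fin 4)) (T : AdmType) (t r s : ℕ), T.Valid t r s ∧
    SameSeq α ((T.word t r s).map σ) ∧ TableF σ T t r s z

end D4Lattice

open D4Lattice

open D4Lattice
namespace D4Lattice
open D4

universe u v

/-! Each pair of distinct indices lies in one of three perfect matchings, and the replacement ijl =
ikl only exchanges the order of two matchings. So an admissible sequence is determined up to
equality by its last index and the number of adjacent pairs in each matching (`sameSeq_of_cnt_eq`).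
These numbers are the lower indices in the table (`AdmType.word_spec`), so e_α depends only on the
leading index and the counts (`IsE.eq`).

On the linear side φ_i Φ⁺ preserves joins, and also meets with any y ≥ e_i, since Φ⁺ρ(e_i) = ker φ_i
(`SubspaceRep.descend_inf`). With the image of e_j a_n^{kl} (`SubspaceRep.descend_e_inf_atom`) this
settles e_α. For f_{α0} the modular law gives the bracket a form containing e_i
(`SubspaceRep.descend_fElem`, `SubspaceRep.descend_fElem'`). Different expressions of f_{α0} have
the same image in every representation (`toHom_fElem_comm`), by induction on the counts, passing
from ρ to Φ⁺ρ. -/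

/-- The perfect matching of `{1, 2, 3, 4}` that contains the pair `{i, j}`. -/
def matching (i j : Fin 4) : Fin 4 := i ^^^ j

theorem matching_comm (i j : Fin 4) : matching i j = matching j i := by
  revert i j; decide

theorem matching_right_inj {i j k : Fin 4} : matching i k = matching j k ↔ i = j := by
  revert i j k; decide

theorem matching_left_inj {i j k : Fin 4} : matching k i = matching k j ↔ i = j := by
  revert i j k; decide

theorem matching_compl {i j k l : Fin 4} (h : [i, j, k, l].Nodup) :
    matching i j = matching k l := by
  revert i j k l; decide

theorem matching_eq_iff {i j k l : Fin 4} (h : i ≠ j) (h' : k ≠ l) :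
    matching i j = matching k l ↔
      (i = k ∧ j = l) ∨ (i = l ∧ j = k) ∨ (i ≠ k ∧ i ≠ l ∧ j ≠ k ∧ j ≠ l) := by
  revert i j k l; decide

/-- An index outside of `{i, j}`. -/
def other (i j : Fin 4) : Fin 4 :=
  if i ≠ 0 ∧ j ≠ 0 then 0 else if i ≠ 1 ∧ j ≠ 1 then 1 else 2

theorem eq_other {i j k l : Fin 4} (h : [i, j, k, l].Nodup) :
    (k = other i j ∧ l = i ^^^ j ^^^ other i j) ∨
      (l = other i j ∧ k = i ^^^ j ^^^ other i j) := by
  revert i j k l; decide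

/-! ### Atomic elements cut by a generator -/

section Atoms

theorem e_le_atom (i j k l : Fin 4) : ∀ n, e i ≤ atom i j k l n
  | 0 => le_top
  | _ + 1 => le_sup_left

/-- Since e_k ≤ a_n^{kl}, the modular law moves a_n^{kl} into the bracket e_j a_n^{kl} + e_i, which
exchanges i and j one level up. The three symmetries feed each other, hence the joint induction. -/
theorem e_inf_atom_symm_aux (n : ℕ) : ∀ i j k l : Fin 4,
    e k ⊓ atom i j k l n = e k ⊓ atom j i k l n ∧ e k ⊓ atom i j l k n = e k ⊓ atom j i l k n ∧
      e k ⊓ atom i j k l n = e k ⊓ atom i j l k n := by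
  induction n with
  | zero => intro i j k l; exact ⟨rfl, rfl, rfl⟩
  | succ n ih =>
    have key : ∀ i j k l : Fin 4, e k ⊓ atom i j k l (n + 1) ≤ e k ⊓ atom j i k l (n + 1) := by
      intro i j k l
      refine le_inf inf_le_left ?_
      have h1 : e k ⊓ (e i ⊔ e j ⊓ atom k l i j n) ≤
          (e j ⊓ atom k l i j n ⊔ e i) ⊓ atom k l i j n :=
        le_inf (inf_le_right.trans (le_of_eq (sup_comm _ _)))
          (inf_le_left.trans (e_le_atom _ _ _ _ _))
      refine h1.trans ?_
      rw [sup_inf_assoc_of_le (e i) (inf_le_right : e j ⊓ atom k l i j n ≤ _),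
        (ih k l i j).2.2]
      exact sup_le_sup inf_le_left le_rfl
    have swap : ∀ i j k l : Fin 4, atom i j k l (n + 1) = atom i j l k (n + 1) := by
      intro i j k l
      change e i ⊔ e j ⊓ atom k l i j n = e i ⊔ e j ⊓ atom l k i j n
      rw [(ih k l j i).2.1]
    intro i j k l
    have h1 := le_antisymm (key i j k l) (key j i k l)
    exact ⟨h1, by rw [← swap i j k l, ← swap j i k l, h1], by rw [swap i j k l]⟩

/-- `e_j aₙ^{kl}` for `{i, j, k, l} = {1, 2, 3, 4}`. -/
def P (j i : Fin 4) (n : ℕ) : D4 :=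
  e j ⊓ atom (other i j) (i ^^^ j ^^^ other i j) i j n

theorem e_inf_atom {i j k l : Fin 4} (h : [i, j, k, l].Nodup) (n : ℕ) :
    e j ⊓ atom k l i j n = P j i n := by
  rcases eq_other h with ⟨h1, h2⟩ | ⟨h1, h2⟩
  · rw [P, ← h2, ← h1]
  · rw [P, ← h2, ← h1, (e_inf_atom_symm_aux n k l j i).2.1]

theorem e_inf_atom' {i j k l : Fin 4} (h : [i, j, k, l].Nodup) (n : ℕ) :
    e j ⊓ atom k l j i n = P j i n := by
  rw [← e_inf_atom h, (e_inf_atom_symm_aux n k l j i).2.2]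

theorem P_zero (j i : Fin 4) : P j i 0 = e j := inf_top_eq _

theorem P_le (j i : Fin 4) (n : ℕ) : P j i n ≤ e j := inf_le_left

theorem P_one {i j k l : Fin 4} (h : [i, j, k, l].Nodup) : P j i 1 = e j ⊓ (e k ⊔ e l) := by
  rw [← e_inf_atom h]
  change e j ⊓ (e k ⊔ e l ⊓ ⊤) = _
  rw [inf_top_eq]

theorem atom_succ_le (i j k l : Fin 4) (n : ℕ) : atom i j k l (n + 1) ≤ atom i j k l n := by
  induction n generalizing i j k l with
  | zero => exact le_top
  | succ n ih => exact sup_le_sup_left (inf_le_inf_left _ (ih _ _ _ _)) _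

theorem P_succ_le (j i : Fin 4) (n : ℕ) : P j i (n + 1) ≤ P j i n :=
  inf_le_inf_left _ (atom_succ_le _ _ _ _ _)

end Atoms

/-! ### Consequences of the modular law -/

section Modular
variable {L : Type*} [Lattice L] [IsModularLattice L]

/-- Used in both directions: cutting summands makes a bracket symmetric, removing a cut makes it
contain e_i. -/
theorem inf_sup_eq_of_le_left {a m b c : L} (ha : a ≤ m) :
    a ⊓ (m ⊓ c ⊔ b) = a ⊓ (m ⊓ c ⊔ m ⊓ b) := by
  have h : m ⊓ (m ⊓ c ⊔ b) = m ⊓ c ⊔ m ⊓ b := by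
    rw [inf_comm, inf_comm m b, sup_inf_assoc_of_le b (inf_le_left : m ⊓ c ≤ m)]
  rw [← h, ← inf_assoc, inf_eq_left.2 ha]

theorem inf_sup_inf_eq_of_le {a e m b c : L} (he : a ≤ e) (hm : a ≤ m) :
    a ⊓ (e ⊓ c ⊔ b ⊓ m) = a ⊓ (e ⊓ m ⊓ c ⊔ e ⊓ m ⊓ b) := by
  rw [inf_sup_eq_of_le_left he, sup_comm,
    show e ⊓ (b ⊓ m) = m ⊓ (e ⊓ b) by ac_rfl, inf_sup_eq_of_le_left hm, sup_comm,
    show m ⊓ (e ⊓ b) = e ⊓ m ⊓ b by ac_rfl, show m ⊓ (e ⊓ c) = e ⊓ m ⊓ c by ac_rfl]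

end Modular

/-- The element `f_{α0}` with leading index `j`, where `i, k, l` are the remaining indices and
`x + 1`, `y`, `z` are the lower indices of the factors with partner `i`, `k`, `l` of `j`. -/
def fElem (j i k l : Fin 4) (x y z : ℕ) : D4 :=
  P j i (x + 1) ⊓ P j k y ⊓ P j l z ⊓ (P j i x ⊓ P j l (z + 1) ⊔ P j i x ⊓ P j k (y + 1))

theorem fElem_swap (j i k l : Fin 4) (x y z : ℕ) : fElem j i k l x y z = fElem j i l k x z y := by
  rw [fElem, fElem, sup_comm, inf_right_comm (P j i (x + 1)) (P j l z)]

/-! ### Images of atomic elements under φ_i Φ⁺ -/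

section Elementary
variable {K : Type u} {X : Type v} [Field K] [AddCommGroup X] [Module K X]

/-- The subspace `φᵢ Φ⁺ρ(z)`. -/
def SubspaceRep.descend (ρ : SubspaceRep K X) (i : Fin 4) (z : D4) : Submodule K X :=
  (ρ.coxeter.toHom z).map (ρ.phi i)

variable (ρ : SubspaceRep K X)

theorem SubspaceRep.mem_coxeter_e {i : Fin 4} {ξ : ρ.coxeterSpace} :
    ξ ∈ ρ.coxeter.toHom (e i) ↔ ξ.1 i = 0 := Iff.rfl

theorem ne_of_nodup {i j k l : Fin 4} (h : [i, j, k, l].Nodup) :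
    i ≠ j ∧ i ≠ k ∧ i ≠ l ∧ j ≠ k ∧ j ≠ l ∧ k ≠ l := by
  revert i j k l; decide

theorem eq_neg_add_neg {A : Type*} [AddCommGroup A] {a b c d : A} (h : a + b + c + d = 0)
    (hb : b = 0) : a = -c + -d := by
  rw [hb, add_zero, add_assoc] at h
  rw [eq_neg_of_add_eq_zero_left h, neg_add]

theorem sum_eq_of_nodup {A : Type*} [AddCommMonoid A] {i j k l : Fin 4} (h : [i, j, k, l].Nodup)
    (f : Fin 4 → A) : ∑ m, f m = f i + f j + f k + f l := by
  have hu : (Finset.univ : Finset (Fin 4)) = {i, j, k, l} := by revert i j k l; decide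
  obtain ⟨h1, h2, h3, h4, h5, h6⟩ := ne_of_nodup h
  rw [hu, Finset.sum_insert (by simp [*]), Finset.sum_insert (by simp [*]),
    Finset.sum_insert (by simp [*]), Finset.sum_singleton]
  simp only [add_assoc]

theorem eq_or_of_nodup {i j k l : Fin 4} (h : [i, j, k, l].Nodup) (m : Fin 4) :
    m = i ∨ m = j ∨ m = k ∨ m = l := by
  revert i j k l m; decide

theorem SubspaceRep.sum_apply {i j k l : Fin 4} (h : [i, j, k, l].Nodup) (ξ : ρ.coxeterSpace) :
    ξ.1 i + ξ.1 j + ξ.1 k + ξ.1 l = 0 := by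
  rw [← sum_eq_of_nodup h ξ.1]; exact ξ.2.2

theorem SubspaceRep.exists_coxeterSpace {i j k l : Fin 4} (h : [i, j, k, l].Nodup) {a b c d : X}
    (ha : a ∈ ρ.toHom (e i)) (hb : b ∈ ρ.toHom (e j)) (hc : c ∈ ρ.toHom (e k))
    (hd : d ∈ ρ.toHom (e l)) (hs : a + b + c + d = 0) :
    ∃ ξ : ρ.coxeterSpace, ξ.1 i = a ∧ ξ.1 j = b ∧ ξ.1 k = c ∧ ξ.1 l = d := by
  obtain ⟨h1, h2, h3, h4, h5, h6⟩ := ne_of_nodup h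
  let f : Fin 4 → X := fun m => if m = i then a else if m = j then b else if m = k then c else d
  have fi : f i = a := by simp [f]
  have fj : f j = b := by simp [f, h1.symm]
  have fk : f k = c := by simp [f, h2.symm, h4.symm]
  have fl : f l = d := by simp [f, h3.symm, h5.symm, h6.symm]
  refine ⟨⟨f, fun m => ?_, ?_⟩, fi, fj, fk, fl⟩
  · rcases eq_or_of_nodup h m with rfl | rfl | rfl | rfl
    · rwa [fi]
    · rwa [fj]
    · rwa [fk]
    · rwa [fl]
  · rw [sum_eq_of_nodup h, fi, fj, fk, fl, hs]

theorem SubspaceRep.descend_mono (i : Fin 4) {y z : D4} (h : y ≤ z) :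
    ρ.descend i y ≤ ρ.descend i z :=
  Submodule.map_mono (OrderHomClass.mono ρ.coxeter.toHom h)

theorem SubspaceRep.descend_sup (i : Fin 4) (y z : D4) :
    ρ.descend i (y ⊔ z) = ρ.descend i y ⊔ ρ.descend i z := by
  rw [descend, map_sup, Submodule.map_sup]; rfl

/-- Vectors of X₀¹ with equal i-th component differ by an element of ker φ_i = Φ⁺ρ(e_i) ≤ Φ⁺ρ(y), so
membership in Φ⁺ρ(y) depends only on the i-th component. -/
theorem SubspaceRep.descend_inf {i : Fin 4} {y : D4} (h : e i ≤ y) (z : D4) :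
    ρ.descend i (y ⊓ z) = ρ.descend i y ⊓ ρ.descend i z := by
  refine le_antisymm (le_inf (ρ.descend_mono i inf_le_left) (ρ.descend_mono i inf_le_right)) ?_
  rintro x ⟨⟨ξ, hξ, rfl⟩, η, hη, hx⟩
  refine ⟨η, ?_, hx⟩
  have h1 : η - ξ ∈ ρ.coxeter.toHom y := by
    refine OrderHomClass.mono ρ.coxeter.toHom h (ρ.mem_coxeter_e.2 ?_)
    exact sub_eq_zero.2 hx
  have h2 : η ∈ ρ.coxeter.toHom y := by
    simpa using add_mem h1 hξ
  rw [map_inf]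
  exact ⟨h2, hη⟩

theorem SubspaceRep.descend_inf' {i : Fin 4} {y : D4} (h : e i ≤ y) (z : D4) :
    ρ.descend i (z ⊓ y) = ρ.descend i z ⊓ ρ.descend i y := by
  rw [inf_comm, ρ.descend_inf h, inf_comm]

theorem SubspaceRep.descend_e_self (i : Fin 4) : ρ.descend i (e i) = ⊥ := by
  rw [eq_bot_iff]
  rintro x ⟨ξ, hξ, rfl⟩
  exact hξ

theorem SubspaceRep.descend_le (i : Fin 4) (z : D4) : ρ.descend i z ≤ ρ.toHom (e i) := by
  rintro x ⟨ξ, -, rfl⟩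
  exact ξ.2.1 i

theorem SubspaceRep.descend_e {i j k l : Fin 4} (h : [i, j, k, l].Nodup) :
    ρ.descend i (e j) = ρ.toHom (e i ⊓ (e k ⊔ e l)) := by
  rw [map_inf, map_sup]
  apply le_antisymm
  · rintro x ⟨ξ, hξ, rfl⟩
    refine ⟨ξ.2.1 i, ?_⟩
    have h0 := ρ.sum_apply h ξ
    change ξ.1 i ∈ _
    rw [eq_neg_add_neg h0 hξ]
    exact Submodule.add_mem_sup (neg_mem (ξ.2.1 k)) (neg_mem (ξ.2.1 l))
  · rintro x ⟨hx, hx'⟩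
    obtain ⟨y, hy, z, hz, rfl⟩ := Submodule.mem_sup.1 hx'
    obtain ⟨ξ, h1, h2, -, -⟩ := ρ.exists_coxeterSpace h hx (zero_mem _) (neg_mem hy) (neg_mem hz)
      (by abel)
    exact ⟨ξ, h2, h1⟩

/-- In the step φ_k is computed before φ_i: as e_k ≤ a^{kl}, membership in Φ⁺ρ(a^{kl}) depends only
on ξ_k. Since ξ_j = 0 gives ξ_i = -ξ_k - ξ_l, restricting ξ_k to ρ(e_k a^{ij}) restricts ξ_i to
ρ(e_l + e_k a^{ij}). -/
theorem SubspaceRep.descend_e_inf_atom (n : ℕ) : ∀ {i j k l : Fin 4}, [i, j, k, l].Nodup →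
    ρ.descend i (e j ⊓ atom k l i j n) = ρ.toHom (e i ⊓ atom k l i j (n + 1)) := by
  induction n with
  | zero =>
    intro i j k l h
    change ρ.descend i (e j ⊓ ⊤) = ρ.toHom (e i ⊓ (e k ⊔ e l ⊓ ⊤))
    rw [inf_top_eq, inf_top_eq, ρ.descend_e h]
  | succ n ih =>
    intro i j k l h
    have h1 : [k, l, i, j].Nodup := by revert i j k l; decide
    have h2 : [k, j, i, l].Nodup := by revert i j k l; decide
    have hk : ρ.descend k (e j ⊓ atom k l i j (n + 1)) =
        ρ.toHom (e k ⊓ (e i ⊔ e l) ⊓ (e k ⊓ atom i j k l (n + 1))) := by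
      rw [ρ.descend_inf' (e_le_atom _ _ _ _ _), ρ.descend_e h2, atom,
        ρ.descend_sup, ρ.descend_e_self, bot_sup_eq, ih h1, ← map_inf, atom]
    have ha : e i ⊓ atom k l i j (n + 1 + 1) = e i ⊓ (e l ⊔ e k ⊓ atom i j k l (n + 1)) := by
      have h3 := (e_inf_atom_symm_aux (n + 1 + 1) k l i j).1
      rw [h3, atom, (e_inf_atom_symm_aux (n + 1) i j k l).2.2]
    rw [ha]
    apply le_antisymm
    · rintro x ⟨ξ, hξ, rfl⟩
      have h0 := ρ.sum_apply h ξ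
      have h3 : ξ.1 j = 0 := by
        rw [map_inf] at hξ; exact hξ.1
      have h4 : ξ.1 k ∈ ρ.toHom (e k ⊓ atom i j k l (n + 1)) := by
        have : ξ.1 k ∈ ρ.descend k (e j ⊓ atom k l i j (n + 1)) := ⟨ξ, hξ, rfl⟩
        rw [hk] at this
        exact OrderHomClass.mono ρ.toHom inf_le_right this
      rw [map_inf, map_sup]
      refine ⟨ξ.2.1 i, ?_⟩
      change ξ.1 i ∈ _
      rw [eq_neg_add_neg h0 h3, add_comm (-ξ.1 k)]
      exact Submodule.add_mem_sup (neg_mem (ξ.2.1 l)) (neg_mem h4)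
    · rw [map_inf ρ.toHom (e i), map_sup]
      rintro x ⟨hx, hx'⟩
      obtain ⟨y, hy, z, hz, rfl⟩ := Submodule.mem_sup.1 hx'
      have hz' : z ∈ ρ.toHom (e k) := OrderHomClass.mono ρ.toHom inf_le_left hz
      have hz2 : z ∈ ρ.descend k (e j ⊓ atom k l i j (n + 1)) := by
        rw [hk, map_inf, map_inf ρ.toHom (e k), map_sup]
        refine ⟨⟨hz', ?_⟩, hz⟩
        rw [show z = (y + z) + -y by abel]
        exact Submodule.add_mem_sup hx (neg_mem hy)
      obtain ⟨η, hη, hηz⟩ := hz2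
      change η.1 k = z at hηz
      obtain ⟨ξ, h3, h4, h5, h6⟩ := ρ.exists_coxeterSpace h hx (zero_mem _) (neg_mem hz')
        (neg_mem hy) (by abel)
      refine ⟨ξ, ?_, h3⟩
      have hη' : -η ∈ ρ.coxeter.toHom (e j ⊓ atom k l i j (n + 1)) := neg_mem hη
      rw [map_inf] at hη' ⊢
      refine ⟨h4, ?_⟩
      -- The k-th component of ξ + η vanishes, so ξ + η lies in ker φ_k, hence in the atomic
      -- subspace; η lies there too.
      have h7 : ξ - -η ∈ ρ.coxeter.toHom (e k) := by
        change ξ.1 k - -η.1 k = 0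
        rw [h5, hηz]; abel
      have h8 := add_mem (OrderHomClass.mono ρ.coxeter.toHom (e_le_atom k l i j (n + 1)) h7) hη'.2
      simpa using h8

theorem SubspaceRep.descend_P {i j : Fin 4} (h : i ≠ j) (n : ℕ) :
    ρ.descend i (P j i n) = ρ.toHom (P i j (n + 1)) := by
  obtain ⟨k, l, h1, h2⟩ : ∃ k l, [i, j, k, l].Nodup ∧ [j, i, k, l].Nodup := by
    revert i j; decide
  rw [← e_inf_atom h1, ← e_inf_atom' h2, ρ.descend_e_inf_atom n h1]

theorem SubspaceRep.descend_top_inf_e (i : Fin 4) :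
    ρ.descend i ⊤ ⊓ ρ.toHom (e i) = ρ.descend i ⊤ :=
  inf_eq_left.2 (ρ.descend_le i ⊤)

theorem SubspaceRep.descend_atom_succ {i j k l : Fin 4} (h : [i, j, k, l].Nodup) (n : ℕ) :
    ρ.descend i (atom i j k l (n + 1)) = ρ.toHom (P i j (n + 1)) := by
  rw [atom, ρ.descend_sup, ρ.descend_e_self, bot_sup_eq, e_inf_atom h,
    ρ.descend_P (ne_of_nodup h).1]

/-- The factor `ρ.descend i ⊤` matters only for n = 0: φ_i(X₀¹) may be smaller than ρ(e_i). -/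
theorem SubspaceRep.descend_atom {i j k l : Fin 4} (h : [i, j, k, l].Nodup) (n : ℕ) :
    ρ.descend i (atom i j k l n) = ρ.descend i ⊤ ⊓ ρ.toHom (P i j n) := by
  cases n with
  | zero => rw [P_zero, ρ.descend_top_inf_e]; rfl
  | succ n =>
    rw [← ρ.descend_atom_succ h, inf_eq_right.2 (ρ.descend_mono i le_top)]

theorem SubspaceRep.descend_atom_inf {i j k l : Fin 4} (h : [i, j, k, l].Nodup) (n : ℕ) (z : D4) :
    ρ.descend i (atom i j k l n ⊓ z) = ρ.toHom (P i j n) ⊓ ρ.descend i z := by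
  rw [ρ.descend_inf (e_le_atom _ _ _ _ _), ρ.descend_atom h, inf_comm (ρ.descend i ⊤), inf_assoc,
    inf_eq_right.2 (ρ.descend_mono i (le_top : z ≤ ⊤))]

/-- The action of `φᵢ Φ⁺` on the products of `e_j` with three atomic elements. -/
theorem SubspaceRep.descend_P_inf {i j k l : Fin 4} (h : [i, j, k, l].Nodup) (x y z : ℕ) :
    ρ.descend i (P j i x ⊓ P j k y ⊓ P j l z) =
      ρ.toHom (P i j (x + 1) ⊓ P i l y ⊓ P i k z) := by
  have h1 : [k, j, i, l].Nodup := by revert i j k l; decide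
  have h2 : [l, j, i, k].Nodup := by revert i j k l; decide
  have h3 : [i, l, k, j].Nodup := by revert i j k l; decide
  have h4 : [i, k, l, j].Nodup := by revert i j k l; decide
  -- The atomic elements with partners k and l can be written to contain e_i; they are split off,
  -- and e_j stays with the third.
  have h5 : P j i x ⊓ P j k y ⊓ P j l z = atom i k l j z ⊓ (atom i l k j y ⊓ P j i x) := by
    rw [← e_inf_atom h1, ← e_inf_atom h2]
    conv_rhs => rw [← inf_eq_left.2 (P_le j i x)]
    ac_rfl
  rw [h5, ρ.descend_atom_inf h4, ρ.descend_atom_inf h3, ρ.descend_P (ne_of_nodup h).1]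
  simp only [map_inf]
  ac_rfl

end Elementary

/-- The table's bracket is not visibly symmetric in b and c. The prefactor lies below e_j and a, so
both summands may be cut by e_j a, which gives the symmetric form `fElem`. -/
theorem inf_sup_eq_fElem {j i k l : Fin 4} {x y z : ℕ} {a b c : D4} (ha : e j ⊓ a = P j i x)
    (hb : e j ⊓ b = P j k (y + 1)) (hc : e j ⊓ c = P j l (z + 1)) :
    P j i (x + 1) ⊓ P j k y ⊓ P j l z ⊓ (e j ⊓ c ⊔ b ⊓ a) = fElem j i k l x y z := by
  have h1 : P j i (x + 1) ⊓ P j k y ⊓ P j l z ≤ P j i (x + 1) := inf_le_left.trans inf_le_left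
  have h2 : P j i (x + 1) ≤ a := (P_succ_le j i x).trans (ha ▸ inf_le_right)
  rw [inf_sup_inf_eq_of_le (h1.trans (P_le _ _ _)) (h1.trans h2), fElem, ← hb, ← hc, ha]
  have h3 : ∀ d, P j i x ⊓ d = P j i x ⊓ (e j ⊓ d) := fun d => by
    rw [← inf_assoc, inf_eq_left.2 (P_le j i x)]
  rw [h3 c, h3 b]

/-! ### Images of f_{α0} and independence of its expression -/

section Elementary
variable {K : Type u} {X : Type v} [Field K] [AddCommGroup X] [Module K X]
variable (ρ : SubspaceRep K X)

theorem SubspaceRep.descend_base {i j k l : Fin 4} (h : [i, j, k, l].Nodup) :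
    ρ.descend i (e j ⊓ (e i ⊔ e k ⊔ e l)) = ρ.toHom (fElem i j k l 0 0 0) := by
  have h1 : [i, k, j, l].Nodup := by revert i j k l; decide
  have h2 : [i, l, j, k].Nodup := by revert i j k l; decide
  have h3 : [j, i, k, l].Nodup := by revert i j k l; decide
  have h4 : [k, i, j, l].Nodup := by revert i j k l; decide
  have h5 : [l, i, j, k].Nodup := by revert i j k l; decide
  rw [ρ.descend_inf' (le_sup_left.trans le_sup_left), ρ.descend_sup, ρ.descend_sup,
    ρ.descend_e_self, bot_sup_eq, ρ.descend_e h, ρ.descend_e h1, ρ.descend_e h2,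
    ← map_sup, ← map_inf, ← P_one h3, ← P_one h4, ← P_one h5, fElem]
  simp only [P_zero, zero_add]
  congr 1
  rw [inf_eq_right.2 (P_le i l 1), inf_eq_right.2 (P_le i k 1), inf_eq_left.2 (P_le i j 1),
    inf_eq_left.2 (P_le i j 1), sup_comm]

/-- Here i is the partner of the distinguished factor. Dropping the cut by `P j i x` from one
summand leaves an atomic element above e_i. -/
theorem SubspaceRep.descend_fElem {i j k l : Fin 4} (h : [i, j, k, l].Nodup) (x y z : ℕ) :
    ρ.descend i (fElem j i k l x y z) = ρ.toHom (fElem i j l k (x + 1) y z) := by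
  have h1 : [k, j, i, l].Nodup := by revert i j k l; decide
  have h2 : [l, j, i, k].Nodup := by revert i j k l; decide
  have h3 : [i, l, k, j].Nodup := by revert i j k l; decide
  have h4 : [i, k, l, j].Nodup := by revert i j k l; decide
  have h5 : fElem j i k l x y z = P j i (x + 1) ⊓ P j k y ⊓ P j l z ⊓
      (atom i l k j (y + 1) ⊔ atom i k l j (z + 1) ⊓ P j i x) := by
    have ha : P j i (x + 1) ⊓ P j k y ⊓ P j l z ≤ P j i x :=
      (inf_le_left.trans inf_le_left).trans (P_succ_le j i x)
    have h6 : ∀ d, P j i x ⊓ (e j ⊓ d) = P j i x ⊓ d := fun d => by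
      rw [← inf_assoc, inf_eq_left.2 (P_le j i x)]
    rw [fElem, ← e_inf_atom h1 (y + 1), ← e_inf_atom h2 (z + 1), h6, h6,
      ← inf_sup_eq_of_le_left ha, sup_comm, inf_comm (P j i x)]
  rw [h5, ρ.descend_inf' ((e_le_atom _ _ _ _ _).trans le_sup_left), ρ.descend_P_inf h,
    ρ.descend_sup, ρ.descend_atom_inf h4, ρ.descend_atom_succ h3,
    ρ.descend_P (ne_of_nodup h).1, ← map_inf, ← map_sup, ← map_inf, fElem,
    ← inf_sup_eq_of_le_left ((inf_le_left.trans inf_le_left).trans (P_succ_le i j (x + 1))),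
    sup_comm, inf_comm (P i k (z + 1))]

/-- Here i is the partner of another factor, and in the table's form of the bracket the summand b ⊓
a already contains e_i. -/
theorem SubspaceRep.descend_fElem' {i j k l : Fin 4} (h : [i, j, k, l].Nodup) (x y z : ℕ) :
    ρ.descend i (fElem j k i l x y z) = ρ.toHom (fElem i l j k x (y + 1) z) := by
  have h1 : [k, j, i, l].Nodup := by revert i j k l; decide
  have h2 : [l, j, i, k].Nodup := by revert i j k l; decide
  have h3 : [i, l, k, j].Nodup := by revert i j k l; decide
  have h4 : [i, k, l, j].Nodup := by revert i j k l; decide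
  have hik : i ≠ k := (ne_of_nodup h).2.1
  -- Absorbs the factor `ρ.descend i ⊤` coming from `descend_atom`.
  have h6 : ρ.toHom (P i k (z + 1)) ≤ ρ.descend i ⊤ := by
    rw [← ρ.descend_P hik]; exact ρ.descend_mono i le_top
  rw [fElem_swap, ← inf_sup_eq_fElem (e_inf_atom h1 x) (e_inf_atom h2 (z + 1))
    (e_inf_atom h (y + 1)), ρ.descend_inf' (le_sup_of_le_right
      (le_inf (e_le_atom _ _ _ _ _) (e_le_atom _ _ _ _ _))),
    show P j k (x + 1) ⊓ P j l z ⊓ P j i y = P j i y ⊓ P j k (x + 1) ⊓ P j l z by ac_rfl,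
    ρ.descend_P_inf h, ρ.descend_sup, e_inf_atom h, ρ.descend_P (ne_of_nodup h).1,
    ρ.descend_atom_inf h4, ρ.descend_atom h3, ← inf_assoc, inf_eq_left.2 h6,
    ← map_inf, ← map_sup, ← map_inf, fElem,
    ← inf_sup_eq_of_le_left ((inf_le_left.trans inf_le_left).trans (P_succ_le i l x)),
    inf_comm (P i l (x + 1)), sup_comm, inf_comm (P i l x)]

/-- `φᵢ φⱼ = -φᵢ φₖ` on `(Φ⁺)² ρ (e_l)`. -/
theorem SubspaceRep.descend_descend_le {i j k l : Fin 4} (h : [i, j, k, l].Nodup) {z z' y : D4}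
    (hz : z ≤ e l) (hy : ρ.coxeter.toHom y = ρ.coxeter.descend j z)
    (hy' : ρ.coxeter.toHom z' = ρ.coxeter.descend k z) :
    ρ.descend i y ≤ ρ.descend i z' := by
  rw [descend, descend, hy, hy']
  rintro x ⟨_, ⟨ξ, hξ, rfl⟩, rfl⟩
  refine ⟨-ξ.1 k, neg_mem ⟨ξ, hξ, rfl⟩, ?_⟩
  -- In the i-th component of this sum only two terms survive: ξ_l = 0 because z ≤ e_l, and ξ_i ∈
  -- Φ⁺ρ(e_i).
  have h0 := ρ.coxeter.sum_apply h ξ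
  have hl : ξ.1 l = 0 := OrderHomClass.mono ρ.coxeter.coxeter.toHom hz hξ
  have hi : (ξ.1 i).1 i = 0 := ξ.2.1 i
  have h1 : (ξ.1 i).1 i + (ξ.1 j).1 i + (ξ.1 k).1 i + (ξ.1 l).1 i = 0 := by
    have := congrArg (fun η : ρ.coxeterSpace => η.1 i) h0
    exact this
  have hl' : (ξ.1 l).1 i = 0 := by rw [hl]; rfl
  rw [hi, hl', zero_add, add_zero] at h1
  exact (eq_neg_of_add_eq_zero_left h1).symm

/-- Both sides come from f of the one-term sequence l, along the equal sequences jkl and jil; there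
the two composite maps differ by a sign. -/
theorem fElem_base_comm {i j k l : Fin 4} (h : [j, i, k, l].Nodup) :
    ρ.toHom (fElem j i k l 0 1 0) = ρ.toHom (fElem j k i l 0 1 0) := by
  have h1 : [k, l, j, i].Nodup := by revert i j k l; decide
  have h2 : [i, l, j, k].Nodup := by revert i j k l; decide
  have h3 : [j, k, l, i].Nodup := by revert i j k l; decide
  have h4 : [j, i, l, k].Nodup := by revert i j k l; decide
  have h5 : [j, k, i, l].Nodup := by revert i j k l; decide
  have ha := ρ.descend_fElem' h3 0 0 0
  have hb := ρ.descend_fElem' h4 0 0 0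
  have hc := ρ.coxeter.descend_base h1
  have hd := ρ.coxeter.descend_base h2
  have he : (e l ⊓ (e k ⊔ e j ⊔ e i)) = e l ⊓ (e i ⊔ e j ⊔ e k) := by
    congr 1; ac_rfl
  rw [he] at hc
  rw [← ha, ← hb]
  exact le_antisymm (ρ.descend_descend_le h5 inf_le_left hc.symm hd.symm)
    (ρ.descend_descend_le h inf_le_left hd.symm hc.symm)

end Elementary

/-- The expressions of `f_{α0}` that start from different atomic factors agree. -/
theorem toHom_fElem_comm {K : Type u} [Field K] (n : ℕ) : ∀ {X : Type v} [AddCommGroup X]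
    [Module K X] (ρ : SubspaceRep K X) {i j k l : Fin 4} (_ : [j, i, k, l].Nodup) (x y z : ℕ),
    x + y + z = n →
    ρ.toHom (fElem j i k l x (y + 1) z) = ρ.toHom (fElem j k i l y (x + 1) z) := by
  induction n with
  | zero =>
    intro X _ _ ρ i j k l h x y z hn
    obtain rfl : x = 0 := by omega
    obtain rfl : y = 0 := by omega
    obtain rfl : z = 0 := by omega
    exact fElem_base_comm ρ h
  | succ n ih =>
    -- Both sides are images under φ_j of expressions with leading index i for Φ⁺ρ, which lowers the
    -- first index.
    have key : ∀ {X : Type v} [AddCommGroup X]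
        [Module K X] (ρ : SubspaceRep K X) {i j k l : Fin 4} (_ : [j, i, k, l].Nodup) (x y z : ℕ),
        x + y + z = n →
        ρ.toHom (fElem j i k l (x + 1) (y + 1) z) =
          ρ.toHom (fElem j k i l y (x + 1 + 1) z) := by
      intro X _ _ ρ i j k l h x y z hn
      have h1 : [j, i, l, k].Nodup := by revert i j k l; decide
      have h2 : [i, j, l, k].Nodup := by revert i j k l; decide
      rw [← ρ.descend_fElem h1, ← ρ.descend_fElem' h1, SubspaceRep.descend, SubspaceRep.descend,
        ih ρ.coxeter h2 x y z hn]
    intro X _ _ ρ i j k l h x y z hn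
    have h0 : [j, k, i, l].Nodup := by revert i j k l; decide
    rcases x with _ | x
    · rcases y with _ | y
      -- With x = y = 0 the passage goes through the leading index l, which lowers z.
      · obtain ⟨z, rfl⟩ : ∃ z', z = z' + 1 := ⟨z - 1, by omega⟩
        have h1 : [j, l, k, i].Nodup := by revert i j k l; decide
        have h2 : [j, l, i, k].Nodup := by revert i j k l; decide
        have h3 : [l, k, i, j].Nodup := by revert i j k l; decide
        rw [fElem_swap, fElem_swap j k, ← ρ.descend_fElem' h2, ← ρ.descend_fElem' h1,
          SubspaceRep.descend, SubspaceRep.descend, fElem_swap, fElem_swap l i,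
          ih ρ.coxeter h3 0 0 z (by omega)]
      · exact (key ρ h0 y 0 z (by omega)).symm
    · exact key ρ h x y z (by omega)

/-! ### Pair counts as invariants of admissible sequences -/

/-- The number of pairs of adjacent indices that lie in the matching `w`. -/
def cnt (w : Fin 4) : List (Fin 4) → ℕ
  | [] => 0
  | [_] => 0
  | i :: j :: α => (if matching i j = w then 1 else 0) + cnt w (j :: α)

theorem cnt_singleton (w i : Fin 4) : cnt w [i] = 0 := rfl

theorem cnt_cons_cons (w i j : Fin 4) (α : List (Fin 4)) :
    cnt w (i :: j :: α) = (if matching i j = w then 1 else 0) + cnt w (j :: α) := rfl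

theorem cnt_cons_congr {w i : Fin 4} {α β : List (Fin 4)} (h : α.head? = β.head?)
    (hc : cnt w α = cnt w β) : cnt w (i :: α) = cnt w (i :: β) := by
  cases α <;> cases β <;> simp_all [cnt_cons_cons]

theorem Step.cons (i : Fin 4) {α β : List (Fin 4)} (h : Step α β) : Step (i :: α) (i :: β) := by
  obtain ⟨u, v, a, b, c, d, h⟩ := h
  exact Step.mk (i :: u) v a b c d h

theorem Step.map (σ : Equiv.Perm (Fin 4)) {α β : List (Fin 4)} (h : Step α β) :
    Step (α.map σ) (β.map σ) := by
  obtain ⟨u, v, a, b, c, d, h⟩ := h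
  have := Step.mk (u.map σ) (v.map σ) (σ a) (σ b) (σ c) (σ d) (h.map σ.injective)
  simpa using this

theorem SameSeq.symm {α β : List (Fin 4)} (h : SameSeq α β) : SameSeq β α :=
  Relation.EqvGen.symm _ _ h

theorem SameSeq.trans {α β γ : List (Fin 4)} (h : SameSeq α β) (h' : SameSeq β γ) : SameSeq α γ :=
  Relation.EqvGen.trans _ _ _ h h'

theorem SameSeq.lift {f : List (Fin 4) → List (Fin 4)} (hf : ∀ {α β}, Step α β → Step (f α) (f β))
    {α β : List (Fin 4)} (h : SameSeq α β) : SameSeq (f α) (f β) := by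
  induction h with
  | rel _ _ h => exact .rel _ _ (hf h)
  | refl _ => exact .refl _
  | symm _ _ _ h => exact h.symm
  | trans _ _ _ _ _ h h' => exact h.trans h'

theorem SameSeq.invariant {A : Type*} {f : List (Fin 4) → A} (hf : ∀ {α β}, Step α β → f α = f β)
    {α β : List (Fin 4)} (h : SameSeq α β) : f α = f β := by
  induction h with
  | rel _ _ h => exact hf h
  | refl _ => rfl
  | symm _ _ _ h => exact h.symm
  | trans _ _ _ _ _ h h' => exact h.trans h'

theorem SameSeq.cons (i : Fin 4) {α β : List (Fin 4)} (h : SameSeq α β) :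
    SameSeq (i :: α) (i :: β) := h.lift (Step.cons i)

theorem SameSeq.map (σ : Equiv.Perm (Fin 4)) {α β : List (Fin 4)} (h : SameSeq α β) :
    SameSeq (α.map σ) (β.map σ) := h.lift (Step.map σ)

theorem SameSeq.head?_eq {α β : List (Fin 4)} (h : SameSeq α β) : α.head? = β.head? :=
  h.invariant fun {_ _} h => by
    obtain ⟨u, v, i, j, k, l, -⟩ := h
    cases u <;> rfl

theorem SameSeq.getLast?_eq {α β : List (Fin 4)} (h : SameSeq α β) :
    α.getLast? = β.getLast? :=
  h.invariant fun {_ _} h => by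
    obtain ⟨u, v, i, j, k, l, -⟩ := h
    simp [List.getLast?_append]

/-- The pairs ij and kl are complementary, as are jl and ik, so a replacement exchanges the
matchings of two consecutive pairs. -/
theorem SameSeq.cnt_eq (w : Fin 4) {α β : List (Fin 4)} (h : SameSeq α β) :
    cnt w α = cnt w β :=
  h.invariant fun {_ _} h => by
    obtain ⟨u, v, i, j, k, l, h⟩ := h
    induction u with
    | nil =>
      have h1 : matching i j = matching k l := matching_compl h
      have h2 : matching j l = matching i k := by revert i j k l; decide
      simp only [List.nil_append, List.cons_append, cnt_cons_cons, h1, h2]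
      ring
    | cons a u ih =>
      refine cnt_cons_congr ?_ ih
      cases u <;> rfl

theorem sameSeq_swap {i j k l : Fin 4} (h : [i, j, k, l].Nodup) (α : List (Fin 4)) :
    SameSeq (i :: j :: l :: α) (i :: k :: l :: α) :=
  .rel _ _ (Step.mk [] α i j k l h)

/-- A pair of a matching that occurs can be brought to the front. -/
theorem exists_sameSeq_cons_cons {w : Fin 4} {α : List (Fin 4)} : ∀ {j : Fin 4},
    (j :: α).IsChain (· ≠ ·) → 1 ≤ cnt w (j :: α) →
    ∃ i β, (j :: i :: β).IsChain (· ≠ ·) ∧ matching j i = w ∧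
      SameSeq (j :: α) (j :: i :: β) := by
  induction α with
  | nil => intro j _ h; simp [cnt] at h
  | cons i α ih =>
    intro j hc hw
    by_cases hji : matching j i = w
    · exact ⟨i, α, hc, hji, .refl _⟩
    rw [cnt_cons_cons, if_neg hji, zero_add] at hw
    rw [List.isChain_cons_cons] at hc
    obtain ⟨k, β, hβ, hw', hs⟩ := ih hc.2 hw
    rw [List.isChain_cons_cons] at hβ
    have hjk : j ≠ k := by
      rintro rfl; exact hji (by rw [matching_comm, hw'])
    -- The pair jl lies in the matching of ik, so replacing i by l moves w one place to the left.
    obtain ⟨l, hl⟩ : ∃ l, [j, i, l, k].Nodup := by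
      have h1 := hc.1
      have h2 := hβ.1
      clear ih hw hji hc hs hw' hβ
      revert i j k; decide
    have h3 : j ≠ l ∧ l ≠ k ∧ matching j l = matching i k := by
      clear ih hw hji hc hs hw' hβ
      revert i j k l; decide
    refine ⟨l, k :: β, ?_, h3.2.2.trans hw', (hs.cons j).trans (sameSeq_swap hl β)⟩
    rw [List.isChain_cons_cons, List.isChain_cons_cons]
    exact ⟨h3.1, h3.2.1, hβ.2⟩

/-- Admissible sequences are classified by their last index and the numbers `cnt`. -/
theorem sameSeq_of_cnt_eq {α : List (Fin 4)} : ∀ {β : List (Fin 4)}, Admissible α → Admissible β →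
    α.getLast? = β.getLast? → (∀ w, cnt w α = cnt w β) → SameSeq α β := by
  induction α with
  | nil => intro β h; exact absurd rfl h.1
  | cons i α ih =>
    intro β hα hβ hl hc
    rcases β with _ | ⟨j, β⟩
    · exact absurd rfl hβ.1
    rcases α with _ | ⟨k, α⟩
    · rcases β with _ | ⟨k, β⟩
      · simp only [List.getLast?_singleton, Option.some.injEq] at hl
        rw [hl]; exact .refl _
      · have := hc (matching j k)
        rw [cnt_singleton, cnt_cons_cons, if_pos rfl] at this
        omega
    · have h1 : 1 ≤ cnt (matching i k) (j :: β) := by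
        rw [← hc, cnt_cons_cons, if_pos rfl]; omega
      -- The first matching of one sequence is brought to the front of the other; stripping it from
      -- both leaves tails with equal counts.
      obtain ⟨m, γ, hγ, hw, hs⟩ := exists_sameSeq_cons_cons hβ.2 h1
      have hα' := List.isChain_cons_cons.1 hα.2
      have hγ' := List.isChain_cons_cons.1 hγ
      have h2 : SameSeq (k :: α) (m :: γ) := by
        refine ih ⟨by simp, hα'.2⟩ ⟨by simp, hγ'.2⟩ ?_ fun w => ?_
        · rw [hs.getLast?_eq] at hl
          simpa [List.getLast?_cons_cons] using hl
        · have := hc w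
          rw [hs.cnt_eq, cnt_cons_cons, cnt_cons_cons, hw] at this
          omega
      have h3 : k = m := by simpa using h2.head?_eq
      subst h3
      rw [matching_right_inj] at hw
      subst hw
      exact (h2.cons j).trans hs.symm

/-- Two pairs lie in the same matching exactly when they are equal or disjoint, which σ preserves.
-/
theorem cnt_map (σ : Equiv.Perm (Fin 4)) {i j : Fin 4} (hij : i ≠ j) {α : List (Fin 4)}
    (h : α.IsChain (· ≠ ·)) : cnt (matching (σ i) (σ j)) (α.map σ) = cnt (matching i j) α := by
  induction α with
  | nil => rfl
  | cons a α ih =>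
    rcases α with _ | ⟨b, α⟩
    · rfl
    · have h' := List.isChain_cons_cons.1 h
      have ih := ih h'.2
      rw [List.map_cons] at ih
      rw [List.map_cons, List.map_cons, cnt_cons_cons, cnt_cons_cons, ih]
      congr 1
      have : matching (σ a) (σ b) = matching (σ i) (σ j) ↔ matching a b = matching i j := by
        rw [matching_eq_iff h'.1 hij, matching_eq_iff (σ.injective.ne h'.1) (σ.injective.ne hij)]
        simp only [σ.injective.eq_iff, ne_eq]
      simp only [this]

/-! ### The table in terms of pair counts -/

theorem pw_zero (i j : Fin 4) : pw i j 0 = [] := rfl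

theorem pw_succ (i j : Fin 4) (n : ℕ) : pw i j (n + 1) = i :: j :: pw i j n := by
  simp [pw, List.replicate_succ]

theorem cnt_pw_append (w i j : Fin 4) (n : ℕ) (β : List (Fin 4)) :
    cnt w (j :: (pw i j n ++ β)) = (if matching i j = w then 2 * n else 0) + cnt w (j :: β) := by
  induction n with
  | zero => simp [pw_zero]
  | succ n ih =>
    rw [pw_succ, List.cons_append, List.cons_append, cnt_cons_cons, cnt_cons_cons, ih,
      matching_comm j i]
    split_ifs <;> ring

theorem cnt_pw (w i j : Fin 4) (n : ℕ) :
    cnt w (j :: pw i j n) = if matching i j = w then 2 * n else 0 := by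
  simpa [cnt_singleton] using cnt_pw_append w i j n []

theorem isChain_pw_append {i j : Fin 4} (h : i ≠ j) (n : ℕ) (β : List (Fin 4)) :
    (j :: (pw i j n ++ β)).IsChain (· ≠ ·) ↔ (j :: β).IsChain (· ≠ ·) := by
  induction n with
  | zero => simp [pw_zero]
  | succ n ih =>
    rw [pw_succ, List.cons_append, List.cons_append, List.isChain_cons_cons,
      List.isChain_cons_cons, ih]
    simp [h, h.symm]

theorem isChain_pw {i j : Fin 4} (h : i ≠ j) (n : ℕ) :
    (j :: pw i j n).IsChain (· ≠ ·) := by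
  simpa using (isChain_pw_append h n []).2 (List.isChain_singleton _)

theorem getLast?_pw_append (i j : Fin 4) (n : ℕ) (β : List (Fin 4)) :
    (j :: (pw i j n ++ β)).getLast? = (j :: β).getLast? := by
  induction n with
  | zero => simp [pw_zero]
  | succ n ih =>
    rw [pw_succ, List.cons_append, List.cons_append, List.getLast?_cons_cons,
      List.getLast?_cons_cons, ih]

theorem getLast?_pw (i j : Fin 4) (n : ℕ) : (j :: pw i j n).getLast? = some j := by
  simpa using getLast?_pw_append i j n []

/-- The index that forms a pair with the leading index in the matching of each factor. -/
def AdmType.partner : AdmType → Fin 3 → Fin 4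
  | .F21 => ![1, 3, 4]
  | .F31 => ![1, 2, 4]
  | .F41 => ![1, 2, 3]
  | .G11 => ![2, 4, 3]
  | .G21 => ![1, 3, 4]
  | .G31 => ![1, 2, 4]
  | .G41 => ![1, 3, 2]
  | .H11 => ![2, 4, 3]
  | .H21 => ![1, 3, 4]
  | .H31 => ![4, 2, 1]
  | .H41 => ![3, 1, 2]

/-- The bridge between sequences and lattice elements: lower indices of atomic factors are pair
counts. -/
theorem AdmType.word_spec (T : AdmType) {t r s : ℕ} (h : T.Valid t r s) :
    Admissible (T.word t r s) ∧ (T.word t r s).getLast? = some 1 ∧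
      (T.word t r s).head? = some T.lead ∧
      ∀ m, cnt (matching T.lead (T.partner m)) (T.word t r s) = (T.factor t r s m).n := by
  cases T
  case' F21 | F31 | F41 => obtain ⟨t, rfl⟩ := Nat.exists_eq_add_of_le' h
  case' G21 | G31 | G41 => obtain ⟨r, rfl⟩ := Nat.exists_eq_add_of_le' h
  case' H11 | H21 | H31 | H41 =>
    obtain ⟨⟨r, rfl⟩, ⟨s, rfl⟩⟩ := h.imp Nat.exists_eq_add_of_le' Nat.exists_eq_add_of_le'
  all_goals
    refine ⟨⟨?_, ?_⟩, ?_, ?_, ?_⟩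
    · simp [word, pw_succ]
    · simp [word, pw_succ, isChain_pw, isChain_pw_append]
    · simp [word, pw_succ, getLast?_pw, getLast?_pw_append]
    · simp [word, pw_succ, lead]
    · intro m
      fin_cases m <;>
        simp +decide [word, pw_succ, lead, partner, factor, cnt_pw, cnt_pw_append, cnt_cons_cons,
          matching] <;> omega

theorem AdmType.partner_nodup (T : AdmType) :
    [T.lead, T.partner 0, T.partner 1, T.partner 2].Nodup := by
  cases T <;> decide

theorem Factor.e_inf_elem {a : Factor} {j p : Fin 4} (h : [a.i, a.j, a.k, a.l].Nodup)
    (h' : (a.k = j ∧ a.l = p) ∨ (a.k = p ∧ a.l = j)) (σ : Equiv.Perm (Fin 4)) (n : ℕ) :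
    e (σ j) ⊓ a.elem σ n = P (σ j) (σ p) n := by
  have key : ∀ i j k l : Fin 4, [i, j, k, l].Nodup → [k, l, i, j].Nodup ∧ [l, k, i, j].Nodup := by
    decide
  have h1 := key _ _ _ _ h
  rcases h' with ⟨rfl, rfl⟩ | ⟨rfl, rfl⟩
  · exact e_inf_atom' (h1.2.map σ.injective) n
  · exact e_inf_atom (h1.1.map σ.injective) n

theorem AdmType.factor_spec (T : AdmType) (t r s : ℕ) (m : Fin 3) (σ : Equiv.Perm (Fin 4)) (n : ℕ) :
    e (σ T.lead) ⊓ (T.factor t r s m).elem σ n = P (σ T.lead) (σ (T.partner m)) n := by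
  refine Factor.e_inf_elem ?_ ?_ σ n <;> cases T <;> fin_cases m <;>
    simp [factor, lead, partner]

theorem cnt_zero {α : List (Fin 4)} (h : α.IsChain (· ≠ ·)) : cnt 0 α = 0 := by
  induction α with
  | nil => rfl
  | cons i α ih =>
    rcases α with _ | ⟨j, α⟩
    · rfl
    · rw [List.isChain_cons_cons] at h
      rw [cnt_cons_cons, ih h.2, if_neg]
      have := h.1
      clear ih h
      revert i j; decide

/-- The type is read off from the parities of the counts. Eight types realize all patterns; `H21`,
`H31`, `H41` are not needed. The matchings 3, 1, 2 contain {1, 2}, {1, 4}, {1, 3}. -/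
theorem exists_word_cnt_eq (p q r : ℕ) : ∃ (T : AdmType) (t r' s : ℕ), T.Valid t r' s ∧
    cnt 3 (T.word t r' s) = p ∧ cnt 1 (T.word t r' s) = q ∧ cnt 2 (T.word t r' s) = r := by
  obtain ⟨p, rfl | rfl⟩ := Nat.even_or_odd' p <;> obtain ⟨q, rfl | rfl⟩ := Nat.even_or_odd' q <;>
    obtain ⟨r, rfl | rfl⟩ := Nat.even_or_odd' r
  · have h : AdmType.G11.Valid p q r := trivial
    refine ⟨.G11, p, q, r, h, ?_, ?_, ?_⟩
    · exact (AdmType.word_spec _ h).2.2.2 0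
    · exact (AdmType.word_spec _ h).2.2.2 1
    · exact (AdmType.word_spec _ h).2.2.2 2
  · have h : AdmType.F31.Valid (r + 1) q p := Nat.succ_pos _
    refine ⟨.F31, r + 1, q, p, h, ?_, ?_, ?_⟩
    · exact (AdmType.word_spec _ h).2.2.2 2
    · exact (AdmType.word_spec _ h).2.2.2 1
    · exact (AdmType.word_spec _ h).2.2.2 0
  · have h : AdmType.F41.Valid (q + 1) r p := Nat.succ_pos _
    refine ⟨.F41, q + 1, r, p, h, ?_, ?_, ?_⟩
    · exact (AdmType.word_spec _ h).2.2.2 2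
    · exact (AdmType.word_spec _ h).2.2.2 0
    · exact (AdmType.word_spec _ h).2.2.2 1
  · have h : AdmType.G21.Valid p (q + 1) r := Nat.succ_pos _
    refine ⟨.G21, p, q + 1, r, h, ?_, ?_, ?_⟩
    · exact (AdmType.word_spec _ h).2.2.2 0
    · exact (AdmType.word_spec _ h).2.2.2 1
    · exact (AdmType.word_spec _ h).2.2.2 2
  · have h : AdmType.F21.Valid (p + 1) q r := Nat.succ_pos _
    refine ⟨.F21, p + 1, q, r, h, ?_, ?_, ?_⟩
    · exact (AdmType.word_spec _ h).2.2.2 0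
    · exact (AdmType.word_spec _ h).2.2.2 1
    · exact (AdmType.word_spec _ h).2.2.2 2
  · have h : AdmType.G41.Valid q (p + 1) r := Nat.succ_pos _
    refine ⟨.G41, q, p + 1, r, h, ?_, ?_, ?_⟩
    · exact (AdmType.word_spec _ h).2.2.2 1
    · exact (AdmType.word_spec _ h).2.2.2 0
    · exact (AdmType.word_spec _ h).2.2.2 2
  · have h : AdmType.G31.Valid r (q + 1) p := Nat.succ_pos _
    refine ⟨.G31, r, q + 1, p, h, ?_, ?_, ?_⟩
    · exact (AdmType.word_spec _ h).2.2.2 2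
    · exact (AdmType.word_spec _ h).2.2.2 1
    · exact (AdmType.word_spec _ h).2.2.2 0
  · have h : AdmType.H11.Valid p (q + 1) (r + 1) := ⟨Nat.succ_pos _, Nat.succ_pos _⟩
    refine ⟨.H11, p, q + 1, r + 1, h, ?_, ?_, ?_⟩
    · exact (AdmType.word_spec _ h).2.2.2 0
    · exact (AdmType.word_spec _ h).2.2.2 1
    · exact (AdmType.word_spec _ h).2.2.2 2

theorem exists_sameSeq_word {α : List (Fin 4)} (σ : Equiv.Perm (Fin 4)) (hα : Admissible α)
    (hl : α.getLast? = some (σ 1)) :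
    ∃ (T : AdmType) (t r s : ℕ), T.Valid t r s ∧ SameSeq α ((T.word t r s).map σ) := by
  have hα' : Admissible (α.map σ.symm) := by
    refine ⟨by simpa using hα.1, ?_⟩
    rw [List.isChain_map]
    exact hα.2.imp fun a b h => σ.symm.injective.ne h
  obtain ⟨T, t, r, s, hv, h3, h1, h2⟩ := exists_word_cnt_eq (cnt 3 (α.map σ.symm))
    (cnt 1 (α.map σ.symm)) (cnt 2 (α.map σ.symm))
  obtain ⟨hw, hw', -⟩ := T.word_spec hv
  refine ⟨T, t, r, s, hv, ?_⟩
  have h : SameSeq (α.map σ.symm) (T.word t r s) := by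
    refine sameSeq_of_cnt_eq hα' hw (by rw [List.getLast?_map, hl, hw']; simp) fun w => ?_
    fin_cases w
    · exact (cnt_zero hα'.2).trans (cnt_zero hw.2).symm
    · exact h1.symm
    · exact h2.symm
    · exact h3.symm
  simpa using h.map σ

/-! ### The elements e_α and f_{α0} as functions of the counts -/

/-- The element `e_α` with leading index `j`, where the lower indices of the atomic factors
are the values of `N` on the matchings. -/
def eElem (j : Fin 4) (N : Fin 4 → ℕ) : D4 :=
  (Finset.univ.erase j).inf fun i => P j i (N (matching j i))

theorem eElem_eq {j i k l : Fin 4} (h : [j, i, k, l].Nodup) (N : Fin 4 → ℕ) :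
    eElem j N = P j i (N (matching j i)) ⊓ P j k (N (matching j k)) ⊓
      P j l (N (matching j l)) := by
  have h1 : Finset.univ.erase j = {i, k, l} := by revert i j k l; decide
  rw [eElem, h1, Finset.inf_insert, Finset.inf_insert, Finset.inf_singleton, inf_assoc]

theorem exists_nodup {i j : Fin 4} (h : i ≠ j) : ∃ k l, [i, j, k, l].Nodup := by
  revert i j; decide

/-- Since {i, l} and {j, k} are complementary, passing from leading index j to i exchanges the
partners k and l, as in `SubspaceRep.descend_P_inf`. -/
theorem cnt_cons_of_nodup {i j k l : Fin 4} (h : [i, j, k, l].Nodup) (β : List (Fin 4)) :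
    cnt (matching i j) (i :: j :: β) = cnt (matching j i) (j :: β) + 1 ∧
      cnt (matching i l) (i :: j :: β) = cnt (matching j k) (j :: β) ∧
      cnt (matching i k) (i :: j :: β) = cnt (matching j l) (j :: β) := by
  have h1 : matching i j ≠ matching i l ∧ matching i j ≠ matching i k ∧
      matching i l = matching j k ∧ matching i k = matching j l := by
    revert i j k l; decide
  obtain ⟨h2, h3, h4, h5⟩ := h1
  rw [cnt_cons_cons, cnt_cons_cons, cnt_cons_cons, if_pos rfl, if_neg h2, if_neg h3,
    matching_comm i j, h4, h5]
  omega

section Elementary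
variable {K : Type u} {X : Type v} [Field K] [AddCommGroup X] [Module K X]
variable (ρ : SubspaceRep K X)

theorem SubspaceRep.descend_eElem {i j : Fin 4} (h : i ≠ j) (β : List (Fin 4)) :
    ρ.descend i (eElem j fun w => cnt w (j :: β)) =
      ρ.toHom (eElem i fun w => cnt w (i :: j :: β)) := by
  obtain ⟨k, l, h⟩ := exists_nodup h
  have h1 : [j, i, k, l].Nodup := by revert i j k l; decide
  have h2 : [i, j, l, k].Nodup := by revert i j k l; decide
  obtain ⟨c1, c2, c3⟩ := cnt_cons_of_nodup h β
  rw [eElem_eq h1, eElem_eq h2, c1, c2, c3, ρ.descend_P_inf h]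

/-- `z` is one of the expressions of `f_{α0}` for a sequence with leading index `j`, where the
lower indices of the atomic factors of `e_α` are the values of `N` on the matchings. -/
def IsFElem (j : Fin 4) (N : Fin 4 → ℕ) (z : D4) : Prop :=
  ∃ (i k l : Fin 4) (x : ℕ), [j, i, k, l].Nodup ∧ N (matching j i) = x + 1 ∧
    z = fElem j i k l x (N (matching j k)) (N (matching j l))

theorem IsFElem.toHom_eq {j : Fin 4} {N : Fin 4 → ℕ} {z z' : D4} (hz : IsFElem j N z)
    (hz' : IsFElem j N z') : ρ.toHom z = ρ.toHom z' := by
  obtain ⟨i, k, l, x, h, hx, rfl⟩ := hz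
  obtain ⟨i', k', l', x', h', hx', rfl⟩ := hz'
  have key : (i' = i ∧ k' = k ∧ l' = l) ∨ (i' = i ∧ k' = l ∧ l' = k) ∨
      (i' = k ∧ k' = i ∧ l' = l) ∨ (i' = k ∧ k' = l ∧ l' = i) ∨
      (i' = l ∧ k' = i ∧ l' = k) ∨ (i' = l ∧ k' = k ∧ l' = i) := by
    clear hx hx'
    revert j i k l i' k' l'; decide
  have h2 : [j, i, l, k].Nodup := by clear hx hx' key h'; revert i j k l; decide
  rcases key with ⟨rfl, rfl, rfl⟩ | ⟨rfl, rfl, rfl⟩ | ⟨rfl, rfl, rfl⟩ | ⟨rfl, rfl, rfl⟩ |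
    ⟨rfl, rfl, rfl⟩ | ⟨rfl, rfl, rfl⟩
  · obtain rfl : x = x' := by omega
    rfl
  · obtain rfl : x = x' := by omega
    rw [fElem_swap]
  · rw [hx, hx', toHom_fElem_comm _ ρ h _ _ _ rfl]
  · rw [hx, hx', fElem_swap j i', toHom_fElem_comm _ ρ h _ _ _ rfl]
  · rw [hx, hx', fElem_swap j k', toHom_fElem_comm _ ρ h2 _ _ _ rfl]
  · rw [hx, hx', fElem_swap j l', toHom_fElem_comm _ ρ h2 _ _ _ rfl, fElem_swap]

theorem IsFElem.descend {i j : Fin 4} (hij : i ≠ j) {β : List (Fin 4)} {z : D4}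
    (hz : IsFElem j (fun w => cnt w (j :: β)) z) :
    ∃ z', IsFElem i (fun w => cnt w (i :: j :: β)) z' ∧ ρ.descend i z = ρ.toHom z' := by
  obtain ⟨m, k, l, x, h, hx, rfl⟩ := hz
  have key : i = m ∨ i = k ∨ i = l := by
    rcases eq_or_of_nodup h i with h | h
    · exact absurd h hij
    · exact h
  rcases key with rfl | rfl | rfl
  · have h1 : [i, j, k, l].Nodup := by clear hx; revert i j k l; decide
    have h2 : [i, j, l, k].Nodup := by clear hx; revert i j k l; decide
    obtain ⟨c1, c2, c3⟩ := cnt_cons_of_nodup h1 β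
    refine ⟨_, ⟨j, l, k, x + 1, h2, ?_, rfl⟩, ?_⟩
    · exact c1.trans (congrArg (· + 1) hx)
    · simp only [c2, c3]; exact ρ.descend_fElem h1 _ _ _
  · have h1 : [i, j, m, l].Nodup := by clear hx; revert i j m l; decide
    have h2 : [i, l, j, m].Nodup := by clear hx; revert i j m l; decide
    obtain ⟨c1, c2, c3⟩ := cnt_cons_of_nodup h1 β
    refine ⟨_, ⟨l, j, m, x, h2, ?_, rfl⟩, ?_⟩
    · exact c2.trans hx
    · simp only [c1, c3]; exact ρ.descend_fElem' h1 _ _ _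
  · have h1 : [i, j, m, k].Nodup := by clear hx; revert i j m k; decide
    have h2 : [i, k, j, m].Nodup := by clear hx; revert i j m k; decide
    obtain ⟨c1, c2, c3⟩ := cnt_cons_of_nodup h1 β
    refine ⟨_, ⟨k, j, m, x, h2, ?_, rfl⟩, ?_⟩
    · exact c2.trans hx
    · simp only [c1, c3]; rw [fElem_swap]; exact ρ.descend_fElem' h1 _ _ _

end Elementary

theorem AdmType.partner_perm_nodup (T : AdmType) (σ : Equiv.Perm (Fin 4))
    (π : Equiv.Perm (Fin 3)) :
    [σ T.lead, σ (T.partner (π 0)), σ (T.partner (π 1)), σ (T.partner (π 2))].Nodup := by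
  have h1 : ([0, 1, 2].map π).Nodup := List.Nodup.map π.injective (by decide)
  have h2 : ∀ f : Fin 3 → Fin 4, ∀ j a b c, [j, f 0, f 1, f 2].Nodup → [a, b, c].Nodup →
      [j, f a, f b, f c].Nodup := by
    decide
  exact (h2 _ _ _ _ _ T.partner_nodup h1).map σ.injective

theorem AdmType.cnt_of_sameSeq {T : AdmType} {t r s : ℕ} (hv : T.Valid t r s)
    {σ : Equiv.Perm (Fin 4)} {α : List (Fin 4)} (h : SameSeq α ((T.word t r s).map σ)) (m : Fin 3) :
    cnt (matching (σ T.lead) (σ (T.partner m))) α = (T.factor t r s m).n := by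
  obtain ⟨h1, -, -, h2⟩ := T.word_spec hv
  have h3 : T.lead ≠ T.partner m := by revert m; cases T <;> decide
  rw [h.cnt_eq, cnt_map σ h3 h1.2, h2]

theorem AdmType.head?_of_sameSeq {T : AdmType} {t r s : ℕ} (hv : T.Valid t r s)
    {σ : Equiv.Perm (Fin 4)} {α : List (Fin 4)} (h : SameSeq α ((T.word t r s).map σ)) :
    α.head? = some (σ T.lead) := by
  obtain ⟨-, -, h1, -⟩ := T.word_spec hv
  rw [h.head?_eq, List.head?_map, h1]; rfl

theorem tableE_eq (σ : Equiv.Perm (Fin 4)) (T : AdmType) (t r s : ℕ) (π : Equiv.Perm (Fin 3)) :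
    tableE σ T t r s = P (σ T.lead) (σ (T.partner (π 0))) (T.factor t r s (π 0)).n ⊓
      P (σ T.lead) (σ (T.partner (π 1))) (T.factor t r s (π 1)).n ⊓
      P (σ T.lead) (σ (T.partner (π 2))) (T.factor t r s (π 2)).n := by
  let g : Fin 3 → D4 := fun m => (T.factor t r s m).elem σ (T.factor t r s m).n
  have h0 : tableE σ T t r s = e (σ T.lead) ⊓ Finset.univ.inf g := by
    rw [show (Finset.univ : Finset (Fin 3)) = {0, 1, 2} by decide, Finset.inf_insert,
      Finset.inf_insert, Finset.inf_singleton, tableE]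
    simp only [inf_assoc, g]
  have h1 : (Finset.univ : Finset (Fin 3)) = {π 0, π 1, π 2} := by
    revert π; decide
  rw [h0, h1, Finset.inf_insert, Finset.inf_insert, Finset.inf_singleton]
  simp only [← AdmType.factor_spec T t r s, g]
  ac_rfl

theorem IsE.eq {α : List (Fin 4)} {z : D4} (h : IsE α z) {j : Fin 4} (hj : α.head? = some j) :
    z = eElem j fun w => cnt w α := by
  obtain ⟨σ, T, t, r, s, hv, hs, rfl⟩ := h
  obtain rfl : σ T.lead = j := by
    simpa [AdmType.head?_of_sameSeq hv hs] using hj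
  rw [eElem_eq (T.partner_perm_nodup σ 1), AdmType.cnt_of_sameSeq hv hs,
    AdmType.cnt_of_sameSeq hv hs, AdmType.cnt_of_sameSeq hv hs, tableE_eq]

theorem SameSeq.length_eq {α β : List (Fin 4)} (h : SameSeq α β) : α.length = β.length :=
  h.invariant fun {_ _} h => by
    obtain ⟨u, v, i, j, k, l, -⟩ := h
    simp

theorem IsF.cases {α : List (Fin 4)} {z : D4} (h : IsF α z) {j : Fin 4} (hj : α.head? = some j) :
    (α = [j] ∧ ∃ i k l, [j, i, k, l].Nodup ∧ z = e j ⊓ (e i ⊔ e k ⊔ e l)) ∨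
      IsFElem j (fun w => cnt w α) z := by
  obtain ⟨σ, T, t, r, s, hv, hs, hf⟩ := h
  obtain rfl : σ T.lead = j := by
    simpa [AdmType.head?_of_sameSeq hv hs] using hj
  cases hf with
  | one =>
    left
    have h1 := hs.length_eq
    refine ⟨?_, _, _, _, ?_, rfl⟩
    · obtain ⟨a, rfl⟩ := List.length_eq_one_iff.1 h1
      simpa using hj
    · exact (show [(1 : Fin 4), 2, 3, 4].Nodup by decide).map σ.injective
  | mk _ _ _ _ π hx =>
    right
    refine ⟨σ (T.partner (π 0)), σ (T.partner (π 1)), σ (T.partner (π 2)),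
      (T.factor t r s (π 0)).n - 1, T.partner_perm_nodup σ π, ?_, ?_⟩
    · dsimp only
      rw [AdmType.cnt_of_sameSeq hv hs]; omega
    · dsimp only
      rw [AdmType.cnt_of_sameSeq hv hs, AdmType.cnt_of_sameSeq hv hs,
        ← inf_sup_eq_fElem (T.factor_spec t r s _ σ _) (T.factor_spec t r s _ σ _)
          (T.factor_spec t r s _ σ _), tableE_eq σ T t r s π, Nat.sub_add_cancel hx]

theorem exists_isE {α : List (Fin 4)} (hα : Admissible α) : ∃ z, IsE α z := by
  obtain ⟨a, ha⟩ : ∃ a, α.getLast? = some a :=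
    ⟨_, List.getLast?_eq_some_getLast hα.1⟩
  obtain ⟨T, t, r, s, hv, hs⟩ := exists_sameSeq_word (Equiv.swap 1 a) hα (by simpa using ha)
  exact ⟨_, _, T, t, r, s, hv, hs, rfl⟩

theorem exists_isF {α : List (Fin 4)} (hα : Admissible α) : ∃ z, IsF α z := by
  obtain ⟨a, ha⟩ : ∃ a, α.getLast? = some a :=
    ⟨_, List.getLast?_eq_some_getLast hα.1⟩
  obtain ⟨T, t, r, s, hv, hs⟩ := exists_sameSeq_word (Equiv.swap 1 a) hα (by simpa using ha)
  by_cases h : ∃ m, 1 ≤ (T.factor t r s m).n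
  · obtain ⟨m, hm⟩ := h
    exact ⟨_, _, T, t, r, s, hv, hs, TableF.mk T t r s (Equiv.swap 0 m) (by simpa using hm)⟩
  -- This happens only for α = 1: every other type or parameter choice has a positive lower index.
  · have h0 : (T.factor t r s 0).n = 0 ∧ (T.factor t r s 1).n = 0 ∧ (T.factor t r s 2).n = 0 := by
      simp only [not_exists, not_le, Nat.lt_one_iff] at h
      exact ⟨h 0, h 1, h 2⟩
    cases T
    case G11 =>
      obtain ⟨h1, h2, h3⟩ : 2 * t = 0 ∧ 2 * r = 0 ∧ 2 * s = 0 := h0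
      obtain ⟨rfl, rfl, rfl⟩ : t = 0 ∧ r = 0 ∧ s = 0 := by omega
      exact ⟨_, _, _, _, _, _, hv, hs, TableF.one⟩
    all_goals
      simp only [AdmType.factor, AdmType.Valid, Matrix.cons_val] at h0 hv
      omega

theorem sup_e_le_of_nodup {j i k l i' k' l' : Fin 4} (h : [j, i, k, l].Nodup)
    (h' : [j, i', k', l'].Nodup) : e i ⊔ e k ⊔ e l ≤ e i' ⊔ e k' ⊔ e l' := by
  have key : ∀ m, m ≠ j → e m ≤ e i' ⊔ e k' ⊔ e l' := fun m hm => by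
    rcases eq_or_of_nodup h' m with rfl | rfl | rfl | rfl
    · exact absurd rfl hm
    · exact le_sup_left.trans le_sup_left
    · exact le_sup_right.trans le_sup_left
    · exact le_sup_right
  obtain ⟨h1, h2, h3, -⟩ := ne_of_nodup h
  exact sup_le (sup_le (key _ h1.symm) (key _ h2.symm)) (key _ h3.symm)

theorem IsF.descend {K : Type u} {X : Type v} [Field K] [AddCommGroup X] [Module K X]
    (ρ : SubspaceRep K X) {i j : Fin 4} (hij : i ≠ j) {β : List (Fin 4)} {z z' : D4}
    (hz : IsF (j :: β) z) (hz' : IsF (i :: j :: β) z') : ρ.descend i z = ρ.toHom z' := by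
  rcases hz'.cases rfl with ⟨h, -⟩ | hz'
  · simp at h
  rcases hz.cases rfl with ⟨h, m, k, l, hn, rfl⟩ | hz
  · obtain rfl : β = [] := by simpa using h
    obtain ⟨a, b, c, x, hn', hx, rfl⟩ := hz'
    clear hz hz'
    dsimp only at hx ⊢
    -- The sequence ij has a single pair, so the distinguished factor must have partner j.
    have hja : matching i j = matching i a := by
      by_contra hja
      rw [cnt_cons_cons, if_neg hja, cnt_singleton] at hx
      omega
    obtain rfl : j = a := matching_left_inj.1 hja
    have hn2 : [j, i, b, c].Nodup := by clear hx hja hn h; revert i j b c; decide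
    obtain ⟨c1, c2, c3⟩ := cnt_cons_of_nodup hn' []
    simp only [cnt_singleton] at c1 c2 c3
    obtain rfl : x = 0 := by omega
    rw [c2, c3, ← ρ.descend_base hn',
      le_antisymm (sup_e_le_of_nodup hn hn2) (sup_e_le_of_nodup hn2 hn)]
  · obtain ⟨z'', h1, h2⟩ := hz.descend ρ hij
    rw [h2, h1.toHom_eq ρ hz']

end D4Lattice

theorem mainTheorem8 :
    (∀ (α : List (Fin 4)) (σ : Equiv.Perm (Fin 4)), Admissible α → α.getLast? = some (σ 1) →
      ∃ (T : AdmType) (t r s : ℕ), T.Valid t r s ∧ SameSeq α ((T.word t r s).map σ)) ∧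
    ∀ (α : List (Fin 4)) (i : Fin 4), Admissible α → α.head? ≠ some i →
      Admissible (i :: α) ∧
      (∃ z, IsE α z) ∧ (∃ z, IsE (i :: α) z) ∧ (∃ z, IsF α z) ∧ (∃ z, IsF (i :: α) z) ∧
      ∀ (K X : Type*) [Field K] [AddCommGroup X] [Module K X] [FiniteDimensional K X]
        (ρ : SubspaceRep K X),
        (∀ z z', IsE α z → IsE (i :: α) z' →
          (ρ.coxeter.toHom z).map (ρ.phi i) = ρ.toHom z') ∧
        (∀ z z', IsF α z → IsF (i :: α) z' →
          (ρ.coxeter.toHom z).map (ρ.phi i) = ρ.toHom z') := by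
  refine ⟨fun α σ hα hl => exists_sameSeq_word σ hα hl, fun α i hα hi => ?_⟩
  rcases α with _ | ⟨j, β⟩
  · exact absurd rfl hα.1
  have hij : i ≠ j := fun h => hi (by rw [h]; rfl)
  have hα' : Admissible (i :: j :: β) := ⟨by simp, List.isChain_cons_cons.2 ⟨hij, hα.2⟩⟩
  refine ⟨hα', exists_isE hα, exists_isE hα', exists_isF hα, exists_isF hα', ?_⟩
  intro K X _ _ _ _ ρ
  refine ⟨fun z z' hz hz' => ?_, fun z z' hz hz' => hz.descend ρ hij hz'⟩
  rw [hz.eq rfl, hz'.eq rfl]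
  exact ρ.descend_eElem hij β
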